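/- Call a lattice in $\mathbb R^2$ irrational if no two distinct points of it lie on a common horizontal or vertical line. For a lattice $\Lambda\subset\mathbb R^2$ let $\operatorname{disp}(\Lambda)$ be the supremum of the areas of the open axis-parallel boxes that contain no point of $\Lambda$, let $\det(\Lambda)$ be the absolute value of the determinant of a generating matrix, and call $\operatorname{disp}(\Lambda)/\det(\Lambda)$ the normalized dispersion. For a two-sided sequence $\mathfrak A=(a_i)_{i\in\mathbb Z}$ of positive integers put $\Delta_i=[a_i,a_{i+1},a_{i+2},\dots]$ and $-\widetilde\Delta_i=[0,a_{i-1},a_{i-2},\dots]$ (continued fractions) and $$\operatorname{disp}(\mathfrak A)=\sup_{i\in\mathbb Z}\ \max_{0\le j<a_i}\frac{(1-j+\Delta_i)(1+j-\widetilde\Delta_i)}{\Delta_i-\widetilde\Delta_i}.$$ Let $\operatorname{disp}(\overline{a})$ and $\operatorname{disp}(\overline{a,1})$ be the values for the constant sequence $(\dots,a,a,a,\dots)$ and for the $2$-periodic sequence $(\dots,a,1,a,1,\dots)$, in which the terms of even index are $a$. An irrational lattice $\Lambda$ has associated sequence $\mathfrak A$ if it is generated by $(1,1)$ and $(-\Delta,-\widetilde\Delta)$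 with $\Delta>1$, $-1<\widetilde\Delta<0$, $\Delta=[a_0,a_1,a_2,\dots]$ and $-\widetilde\Delta=[0,a_{-1},a_{-2},\dots]$. A quadratic lattice is a lattice $\{(\alpha,\overline\alpha):\alpha\in\mathbb Z[\delta]\}$, where $\mathbb Z[\delta]$, with $\delta$ irrational, is a subring of the ring of integers of a real quadratic field and $\overline\alpha$ is the conjugate of $\alpha$. Theorem. Let $a\ge 1$ be an integer. (i) If $\Lambda$ is an irrational lattice with associated sequence $\mathfrak A=(a_i)_{i\in\mathbb Z}$ and $\max_i a_i=a$, then $$\operatorname{disp}(\overline a)\le\frac{\operatorname{disp}(\Lambda)}{\det(\Lambda)}\le\operatorname{disp}(\overline{a,1}).$$ (ii) Both bounds are attained by quadratic lattices: there is a quadratic lattice with associated sequence $(\overline a)$ whose normalized dispersion is $\operatorname{disp}(\overline a)$, and a quadratic lattice with associated sequence $(\overline{a,1})$ whose normalized dispersion is $\operatorname{disp}(\overline{a,1})$. (iii) $\operatorname{disp}(\overline{a,1})<\operatorname{disp}(\overline a)+\tfrac12$. -/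

import Mathlib

open Filter Topology MeasureTheory
open scoped ENNReal

noncomputable section

namespace LatticeDispersion

/- Lattices in the plane and their dispersion -/

/-- The lattice generated by the columns of a real `2 × 2` matrix. -/
def latticeOf (A : Matrix (Fin 2) (Fin 2) ℝ) : Submodule ℤ (Fin 2 → ℝ) :=
  Submodule.span ℤ (Set.range A.col)

/-- The open axis-parallel box `(x 0, y 0) × (x 1, y 1)`. -/
def box (x y : Fin 2 → ℝ) : Set (Fin 2 → ℝ) :=
  Set.pi Set.univ fun k => Set.Ioo (x k) (y k)

/-- The dispersion: the supremum of the areas of the open axis-parallel boxes that contain no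
point of the lattice. It takes the value `∞` if these areas are unbounded. -/
def disp (L : Submodule ℤ (Fin 2 → ℝ)) : ℝ≥0∞ :=
  ⨆ (x : Fin 2 → ℝ) (y : Fin 2 → ℝ) (_ : Disjoint (box x y) (L : Set (Fin 2 → ℝ))),
    volume (box x y)

/-- The normalized dispersion `disp(Λ) / det(Λ)`, where `det(Λ)` is the covolume of the lattice,
i.e. `|det A|` for every generating matrix `A` (see `covolume_latticeOf`). -/
def normalizedDisp (L : Submodule ℤ (Fin 2 → ℝ)) : ℝ≥0∞ :=
  disp L / ENNReal.ofReal (ZLattice.covolume L)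

/-- No two points of the lattice lie on the same vertical or horizontal line. -/
def IsIrrationalLattice (L : Submodule ℤ (Fin 2 → ℝ)) : Prop :=
  ∀ p ∈ L, ∀ q ∈ L, ∀ k : Fin 2, p k = q k → p = q

/-- The covolume of the lattice generated by an invertible matrix is `|det A|`. -/
theorem covolume_latticeOf (A : Matrix (Fin 2) (Fin 2) ℝ) (hA : A.det ≠ 0) :
    ZLattice.covolume (latticeOf A) = |A.det| := by
  have hli : LinearIndependent ℝ A.col :=
    Matrix.linearIndependent_cols_iff_isUnit.2 ((Matrix.isUnit_iff_isUnit_det A).2 hA.isUnit)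
  let B : Module.Basis (Fin 2) ℝ (Fin 2 → ℝ) :=
    basisOfLinearIndependentOfCardEqFinrank hli (by simp)
  have hB : (B : Fin 2 → Fin 2 → ℝ) = A.col := by simp [B]
  have hL : latticeOf A = Submodule.span ℤ (Set.range B) := by rw [latticeOf, hB]
  rw [hL, ZLattice.covolume_eq_measure_fundamentalDomain _ _ (ZSpan.isAddFundamentalDomain B volume),
    ZSpan.volume_real_fundamentalDomain, hB, ← Matrix.det_transpose]
  rfl

/- Continued fractions -/

/-- The infinite continued fraction `[b 0, b 1, b 2, …]` (with all partial numerators `1`). -/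
def contFrac (b : ℕ → ℕ) : GenContFract ℝ :=
  ⟨(b 0 : ℝ), Stream'.Seq.ofStream fun n => ⟨1, (b (n + 1) : ℝ)⟩⟩

/-- The value of `[b 0, b 1, b 2, …]`: the limit of its convergents (see `tendsto_convs`). -/
def cfValue (b : ℕ → ℕ) : ℝ :=
  limUnder atTop fun n => (contFrac b).convs n

/-- The convergents do converge to `cfValue b` when `b 1, b 2, …` are positive. -/
theorem tendsto_convs (b : ℕ → ℕ) (hb : ∀ n, 0 < b (n + 1)) :
    Tendsto (fun n => (contFrac b).convs n) atTop (𝓝 (cfValue b)) := by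
  have hs : ∀ n, (contFrac b).s.get? n = some ⟨1, (b (n + 1) : ℝ)⟩ := fun n => rfl
  have hb1 : ∀ n, (1 : ℝ) ≤ b (n + 1) := fun n => by exact_mod_cast hb n
  have hd0 : (contFrac b).dens 0 = 1 := GenContFract.zeroth_den_eq_one
  have hd1 : (contFrac b).dens 1 = b 1 := GenContFract.first_den_eq (hs 0)
  have hrec : ∀ n, (contFrac b).dens (n + 2) =
      b (n + 2) * (contFrac b).dens (n + 1) + 1 * (contFrac b).dens n := fun n =>
    GenContFract.dens_recurrence (hs (n + 1)) rfl rfl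
  have hmono : ∀ n, 1 ≤ (contFrac b).dens n ∧
      (contFrac b).dens n ≤ (contFrac b).dens (n + 1) := by
    intro n
    induction n with
    | zero => rw [hd0, hd1]; exact ⟨le_rfl, hb1 0⟩
    | succ n ih =>
      refine ⟨ih.1.trans ih.2, ?_⟩
      rw [hrec n]
      nlinarith [hb1 (n + 1), ih.1, ih.2]
  have hprod : ∀ n, (2 : ℝ) ^ n ≤ (contFrac b).dens n * (contFrac b).dens (n + 1) := by
    intro n
    induction n with
    | zero => rw [hd0, hd1]; simpa using hb1 0
    | succ n ih =>
      have h0 := hmono n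
      have h2 : 2 * (contFrac b).dens n ≤ (contFrac b).dens (n + 2) := by
        rw [hrec n]; nlinarith [hb1 (n + 1), h0.1, h0.2]
      rw [pow_succ]
      nlinarith [h0.1, h0.2]
  have hdet : ∀ n, |(contFrac b).nums n * (contFrac b).dens (n + 1) -
      (contFrac b).dens n * (contFrac b).nums (n + 1)| = 1 := by
    intro n
    rw [GenContFract.determinant, Finset.abs_prod]
    refine Finset.prod_eq_one fun i _ => ?_
    rw [GenContFract.partNum_eq_s_a (hs i)]
    simp
  have hdist : ∀ n, dist ((contFrac b).convs n) ((contFrac b).convs (n + 1)) ≤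
      1 * (1 / 2 : ℝ) ^ n := by
    intro n
    have p0 : 0 < (contFrac b).dens n := lt_of_lt_of_le one_pos (hmono n).1
    have p1 : 0 < (contFrac b).dens (n + 1) := lt_of_lt_of_le one_pos (hmono (n + 1)).1
    rw [Real.dist_eq, GenContFract.conv_eq_num_div_den, GenContFract.conv_eq_num_div_den,
      div_sub_div _ _ p0.ne' p1.ne', abs_div, hdet n, abs_of_pos (mul_pos p0 p1), one_mul,
      one_div_pow]
    exact one_div_le_one_div_of_le (by positivity) (hprod n)
  have hc : CauchySeq fun n => (contFrac b).convs n :=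
    cauchySeq_of_le_geometric _ _ (by norm_num) hdist
  exact tendsto_nhds_limUnder (cauchySeq_tendsto_of_complete hc)

/- Two-sided sequences -/

/-- `Δ_i = [a_i, a_{i+1}, a_{i+2}, …]`. -/
def genRight (a : ℤ → ℕ) (i : ℤ) : ℝ :=
  cfValue fun n => a (i + n)

/-- `Δ̃_i = -[0, a_{i-1}, a_{i-2}, …]`. -/
def genLeft (a : ℤ → ℕ) (i : ℤ) : ℝ :=
  -cfValue fun n => if n = 0 then 0 else a (i - n)

/-- The dispersion of a two-sided sequence of positive integers:
`sup_i max_{0 ≤ j < a_i} (1 - j + Δ_i) (1 + j - Δ̃_i) / (Δ_i - Δ̃_i)`. All these quotients are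
positive when all `a_i` are. -/
def seqDisp (a : ℤ → ℕ) : ℝ≥0∞ :=
  ⨆ (i : ℤ) (j : ℕ) (_ : j < a i),
    ENNReal.ofReal ((1 - j + genRight a i) * (1 + j - genLeft a i) /
      (genRight a i - genLeft a i))

/-- The constant sequence `(…, m, m, m, …)`. -/
def constSeq (m : ℕ) : ℤ → ℕ := fun _ => m

/-- The `2`-periodic sequence `(…, m, 1, m, 1, …)`. -/
def altSeq (m : ℕ) : ℤ → ℕ := fun i => if Even i then m else 1

/-- `L` is the irrational lattice generated by the columns of `!![1, -Δ; 1, -Δ']`, where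
`1 < Δ` and `-1 < Δ' < 0`, and `a` is its associated sequence of positive integers:
`Δ = [a_0, a_1, a_2, …]` and `-Δ' = [0, a_{-1}, a_{-2}, …]`. -/
def HasSequence (L : Submodule ℤ (Fin 2 → ℝ)) (a : ℤ → ℕ) : Prop :=
  ∃ Δ Δ' : ℝ, 1 < Δ ∧ -1 < Δ' ∧ Δ' < 0 ∧
    L = latticeOf !![1, -Δ; 1, -Δ'] ∧ IsIrrationalLattice L ∧
    (∀ i, 0 < a i) ∧ Δ = genRight a 0 ∧ Δ' = genLeft a 0

/- Quadratic lattices -/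

/-- The standard generator of the ring of integers of `ℚ(√d)`, for `d` squarefree. -/
def intGen (d : ℕ) : ℝ := if d % 4 = 1 then (1 + √(d : ℝ)) / 2 else √(d : ℝ)

/-- Quadratic lattices: the lattices `{(α, ᾱ) : α ∈ ℤ[δ]}` where `ℤ[δ]`, with `δ` irrational, is a
subring of the ring of integers of a real quadratic field `ℚ(√d)`, and the conjugate of
`r + s √d`, with `r` and `s` rational, is `r - s √d`. -/
def IsQuadraticLattice (L : Submodule ℤ (Fin 2 → ℝ)) : Prop :=
  ∃ (d : ℕ) (δ : ℝ), 1 < d ∧ Squarefree d ∧ Irrational δ ∧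
    δ ∈ Algebra.adjoin ℤ ({intGen d} : Set ℝ) ∧
    ∀ p : Fin 2 → ℝ, p ∈ L ↔ ∃ r s : ℚ,
      (r : ℝ) + s * √(d : ℝ) ∈ Algebra.adjoin ℤ ({δ} : Set ℝ) ∧
      p = ![(r : ℝ) + s * √(d : ℝ), (r : ℝ) - s * √(d : ℝ)]

end LatticeDispersion

end

open LatticeDispersion

namespace LatticeDispersion

/- Recursions for continued fractions -/

/-! The continued fractions produce lattice vectors `v_i` with coordinates `±X_i` and `Y_i`, where
the sign alternates with `i`, `X_{i-1} / X_i = Δ_i` and `Y_{i-1} / Y_i = -Δ̃_i`. They satisfy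
`v_{i+1} = v_{i-1} + a_i v_i`. For `0 ≤ j < a_i` the vectors `v_i` and `v_{i-1} + j v_i` form a
basis, one in the open first quadrant and one in the open second. Such a basis `(p₁, p₂)`, `(-q₁,
q₂)` gives an empty box of width `p₁ + q₁` and height `p₂ + q₂`, while an empty box wider than `max
p₁ q₁` has height at most `p₂ + q₂`. The intervals `(max p₁ q₁, p₁ + q₁]` of all these bases cover
the positive reals, so the boxes of the bases determine the dispersion (`IsChain.disp_eq`). Division
by the determinant gives `normalizedDisp_eq_seqDisp`.

What remains concerns `A * B / (A + B - 2)`, which grows in each argument when both are at least 2.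
Terms with `j = 0` are at most 2 and do not matter once some partial quotient is at least 2; if all
are 1, the sequence is constant. The upper bound follows because bounding the partial quotients by
`m` bounds the fractional parts on both sides by `1 / [1, m, 1, m, …]`, and `altSeq` attains both
bounds at once next to an entry `m`.

For the lower bound (`exists_le_boxArea`), let `γ = 1 / [m, m, …]`. A fractional part below `γ`
forces the neighbouring quotient to be `m` and the fractional part beyond it to exceed `γ`. Hence
some entry `m` has both fractional parts at least `γ`, or two adjacent entries `m` can be compared
by `boxArea_le_perturb`: at one of them the gain on one side outweighs the loss on the other. The
bounds are attained because, for the two periodic sequences, `Δ` and `Δ̃` are conjugate quadratic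
integers. -/

theorem contFrac_convs_succ (b : ℕ → ℕ) (hb : ∀ n, 0 < b (n + 1)) (n : ℕ) :
    (contFrac b).convs (n + 1) = b 0 + 1 / (contFrac fun k => b (k + 1)).convs n := by
  -- `convs'` evaluates the fraction from the front, so for it the recursion is definitional;
  -- positivity makes it agree with `convs`.
  have key : ∀ (c : ℕ → ℕ) (_ : ∀ n, 0 < c (n + 1)) n,
      (contFrac c).convs n = (contFrac c).convs' n := by
    intro c hc n
    refine GenContFract.convs_eq_convs' fun {gp k} _ hgp => ?_
    have : gp = ⟨1, (c (k + 1) : ℝ)⟩ := (Option.some.inj hgp).symm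
    subst this
    exact ⟨one_pos, Nat.cast_pos.2 (hc k)⟩
  rw [key b hb, key _ fun n => hb (n + 1)]
  rfl

theorem one_le_contFrac_convs (b : ℕ → ℕ) (hb : ∀ n, 0 < b n) (n : ℕ) :
    1 ≤ (contFrac b).convs n := by
  have h0 : (1 : ℝ) ≤ b 0 := by exact_mod_cast hb 0
  induction n generalizing b with
  | zero => simpa [contFrac] using h0
  | succ n ih =>
    rw [contFrac_convs_succ b fun n => hb (n + 1)]
    have h1 := ih (fun k => b (k + 1)) (fun k => hb (k + 1)) (by exact_mod_cast hb 1)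
    have : 0 < 1 / (contFrac fun k => b (k + 1)).convs n := by positivity
    linarith

theorem one_le_cfValue (b : ℕ → ℕ) (hb : ∀ n, 0 < b n) : 1 ≤ cfValue b :=
  ge_of_tendsto' (tendsto_convs b fun n => hb (n + 1)) (one_le_contFrac_convs b hb)

theorem cfValue_eq (b : ℕ → ℕ) (hb : ∀ n, 0 < b (n + 1)) :
    cfValue b = b 0 + 1 / cfValue fun k => b (k + 1) := by
  have h1 := (tendsto_add_atTop_iff_nat 1).2 (tendsto_convs b hb)
  simp only [contFrac_convs_succ b hb] at h1
  have hne : (cfValue fun k => b (k + 1)) ≠ 0 :=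
    (zero_lt_one.trans_le (one_le_cfValue _ fun n => hb n)).ne'
  have h2 := (tendsto_const_nhds (x := (1 : ℝ))).div
    (tendsto_convs (fun k => b (k + 1)) fun n => hb (n + 1)) hne
  exact tendsto_nhds_unique h1 (h2.const_add _)

theorem genRight_eq (a : ℤ → ℕ) (ha : ∀ i, 0 < a i) (i : ℤ) :
    genRight a i = a i + 1 / genRight a (i + 1) := by
  rw [genRight, cfValue_eq _ fun n => ha _, genRight]
  congr 2
  · simp
  · congr 1
    funext k
    congr 1
    push_cast
    ring

theorem one_le_genRight (a : ℤ → ℕ) (ha : ∀ i, 0 < a i) (i : ℤ) : 1 ≤ genRight a i :=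
  one_le_cfValue _ fun _ => ha _

theorem lt_genRight (a : ℤ → ℕ) (ha : ∀ i, 0 < a i) (i : ℤ) : (a i : ℝ) < genRight a i := by
  rw [genRight_eq a ha]
  have := one_le_genRight a ha (i + 1)
  have : 0 < 1 / genRight a (i + 1) := by positivity
  linarith

theorem one_lt_genRight (a : ℤ → ℕ) (ha : ∀ i, 0 < a i) (i : ℤ) : 1 < genRight a i :=
  lt_of_le_of_lt (by exact_mod_cast ha i) (lt_genRight a ha i)

/-- Reflecting the sequence turns left expansions into right ones, so that bounds for `genRight`
carry over to `genLeft`. -/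
theorem genLeft_eq (a : ℤ → ℕ) (ha : ∀ i, 0 < a i) (i : ℤ) :
    -genLeft a i = 1 / genRight (fun k => a (-k)) (1 - i) := by
  rw [genLeft, neg_neg, cfValue_eq _ fun n => by simpa using ha _, genRight]
  simp only [if_pos, Nat.cast_zero, zero_add]
  congr 2
  funext k
  simp only [Nat.add_eq_zero_iff, one_ne_zero, and_false, if_false]
  congr 1
  push_cast
  ring

theorem genLeft_succ (a : ℤ → ℕ) (ha : ∀ i, 0 < a i) (i : ℤ) :
    -genLeft a (i + 1) = 1 / (a i + -genLeft a i) := by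
  rw [genLeft_eq a ha, genLeft_eq a ha i, genRight_eq _ (fun k => ha (-k))]
  congr 4 <;> ring

theorem genLeft_pos (a : ℤ → ℕ) (ha : ∀ i, 0 < a i) (i : ℤ) : 0 < -genLeft a i := by
  rw [genLeft_eq a ha]
  have := one_le_genRight _ (fun k => ha (-k)) (1 - i)
  positivity

theorem genLeft_lt_one (a : ℤ → ℕ) (ha : ∀ i, 0 < a i) (i : ℤ) : -genLeft a i < 1 := by
  rw [genLeft_eq a ha]
  have := one_lt_genRight _ (fun k => ha (-k)) (1 - i)
  rw [div_lt_one (by linarith)]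
  exact this

/- Empty boxes -/

/-- `(p₁, p₂)` and `(-q₁, q₂)` form a basis of `L`, the first of these vectors lies in the open
first quadrant and the second one in the open second quadrant. -/
structure IsQuadrantBasis (L : Submodule ℤ (Fin 2 → ℝ)) (p₁ p₂ q₁ q₂ : ℝ) : Prop where
  p₁_pos : 0 < p₁
  p₂_pos : 0 < p₂
  q₁_pos : 0 < q₁
  q₂_pos : 0 < q₂
  mem_iff : ∀ z, z ∈ L ↔ ∃ a b : ℤ, z 0 = a * p₁ - b * q₁ ∧ z 1 = a * p₂ + b * q₂

theorem mem_box_iff (x y z : Fin 2 → ℝ) :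
    z ∈ box x y ↔ (x 0 < z 0 ∧ z 0 < y 0) ∧ x 1 < z 1 ∧ z 1 < y 1 := by
  simp [box, Set.mem_pi, Fin.forall_fin_two]

theorem volume_box (x y : Fin 2 → ℝ) :
    volume (box x y) = ENNReal.ofReal (y 0 - x 0) * ENNReal.ofReal (y 1 - x 1) := by
  rw [box, Real.volume_pi_Ioo, Fin.prod_univ_two]

/-- The empty box has the origin on its lower side and the sum of the two basis vectors on its upper
side. A combination whose coefficients are both positive or both nonpositive misses it vertically,
any other one horizontally. -/
theorem IsQuadrantBasis.le_disp {L : Submodule ℤ (Fin 2 → ℝ)} {p₁ p₂ q₁ q₂ : ℝ}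
    (h : IsQuadrantBasis L p₁ p₂ q₁ q₂) :
    ENNReal.ofReal ((p₁ + q₁) * (p₂ + q₂)) ≤ disp L := by
  have hp₁ := h.p₁_pos
  have hp₂ := h.p₂_pos
  have hq₁ := h.q₁_pos
  have hq₂ := h.q₂_pos
  have hd : Disjoint (box ![-q₁, 0] ![p₁, p₂ + q₂]) (L : Set (Fin 2 → ℝ)) := by
    rw [Set.disjoint_left]
    intro z hz hzL
    obtain ⟨a, b, h0, h1⟩ := (h.mem_iff z).1 hzL
    rw [mem_box_iff, h0, h1] at hz
    simp only [Matrix.cons_val_zero, Matrix.cons_val_one] at hz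
    obtain ⟨⟨h2, h3⟩, h4, h5⟩ := hz
    rcases le_or_gt a 0 with ha | ha <;> rcases le_or_gt b 0 with hb | hb
    · have ha' : (a : ℝ) ≤ 0 := by exact_mod_cast ha
      have hb' : (b : ℝ) ≤ 0 := by exact_mod_cast hb
      nlinarith
    · have ha' : (a : ℝ) ≤ 0 := by exact_mod_cast ha
      have hb' : (1 : ℝ) ≤ b := by exact_mod_cast hb
      nlinarith
    · have ha' : (1 : ℝ) ≤ a := by exact_mod_cast ha
      have hb' : (b : ℝ) ≤ 0 := by exact_mod_cast hb
      nlinarith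
    · have ha' : (1 : ℝ) ≤ a := by exact_mod_cast ha
      have hb' : (1 : ℝ) ≤ b := by exact_mod_cast hb
      nlinarith
  refine le_trans (le_of_eq ?_) (le_iSup₂_of_le _ _ (le_iSup_of_le hd le_rfl))
  rw [volume_box, ← ENNReal.ofReal_mul]
  · simp
  · simp only [Matrix.cons_val_zero]
    linarith

/-- From a lattice point in a vertical strip of width `w > max p₁ q₁` one reaches another one by a
step upwards of height at most `p₂ + q₂`. -/
theorem IsQuadrantBasis.exists_step {L : Submodule ℤ (Fin 2 → ℝ)} {p₁ p₂ q₁ q₂ : ℝ}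
    (h : IsQuadrantBasis L p₁ p₂ q₁ q₂) {c w : ℝ} (hp : p₁ < w) (hq : q₁ < w)
    {z : Fin 2 → ℝ} (hz : z ∈ L) (hc : c < z 0) (hw : z 0 < c + w) :
    ∃ z' ∈ L, c < z' 0 ∧ z' 0 < c + w ∧ z 1 + min p₂ q₂ ≤ z' 1 ∧ z' 1 ≤ z 1 + (p₂ + q₂) := by
  have hp₂ := h.p₂_pos
  have hq₂ := h.q₂_pos
  have hp₁ := h.p₁_pos
  have hm : min p₂ q₂ ≤ p₂ := min_le_left _ _
  have hm' : min p₂ q₂ ≤ q₂ := min_le_right _ _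
  obtain ⟨a, b, h0, h1⟩ := (h.mem_iff z).1 hz
  by_cases h2 : z 0 + p₁ < c + w
  · refine ⟨![z 0 + p₁, z 1 + p₂], (h.mem_iff _).2 ⟨a + 1, b, ?_, ?_⟩, ?_⟩
    · simp [h0]; ring
    · simp [h1]; ring
    · simp only [Matrix.cons_val_zero, Matrix.cons_val_one]
      refine ⟨?_, ?_, ?_, ?_⟩ <;> linarith
  by_cases h3 : c < z 0 - q₁
  · refine ⟨![z 0 - q₁, z 1 + q₂], (h.mem_iff _).2 ⟨a, b + 1, ?_, ?_⟩, ?_⟩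
    · simp [h0]; ring
    · simp [h1]; ring
    · have := h.q₁_pos
      simp only [Matrix.cons_val_zero, Matrix.cons_val_one]
      refine ⟨?_, ?_, ?_, ?_⟩ <;> linarith
  -- If both single moves leave the strip, then `z 0 + p₁ ≥ c + w > c + q₁` and `z 0 - q₁ ≤ c < c +
  -- w - p₁`, so their sum stays inside.
  · refine ⟨![z 0 + p₁ - q₁, z 1 + (p₂ + q₂)], (h.mem_iff _).2 ⟨a + 1, b + 1, ?_, ?_⟩, ?_⟩
    · simp [h0]; ring
    · simp [h1]; ring
    · simp only [Matrix.cons_val_zero, Matrix.cons_val_one]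
      refine ⟨?_, ?_, ?_, ?_⟩ <;> linarith

/-- Every vertical strip of width `w > max p₁ q₁` contains arbitrarily low lattice points. -/
theorem IsQuadrantBasis.exists_mem_strip {L : Submodule ℤ (Fin 2 → ℝ)} {p₁ p₂ q₁ q₂ : ℝ}
    (h : IsQuadrantBasis L p₁ p₂ q₁ q₂) {w : ℝ} (hp : p₁ < w) (hq : q₁ < w) (c d : ℝ) :
    ∃ z ∈ L, c < z 0 ∧ z 0 < c + w ∧ z 1 < d := by
  have hp₁ := h.p₁_pos
  have hp₂ := h.p₂_pos
  have hq₁ := h.q₁_pos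
  have hq₂ := h.q₂_pos
  obtain ⟨N, hN⟩ := exists_nat_gt (-d / (p₂ + q₂))
  rw [div_lt_iff₀ (by positivity)] at hN
  -- Start at `-N` times the sum of the basis vectors, already below `d`. Then subtract copies of
  -- whichever basis vector leads towards the strip: this only moves further down, and its
  -- horizontal steps are too short to jump over the strip.
  set s : ℝ := -N * (p₁ - q₁) with hs
  rcases le_or_gt s c with h1 | h1
  · obtain ⟨n, hn⟩ : ∃ n : ℕ, n = Nat.floor ((c - s) / q₁) := ⟨_, rfl⟩
    have hf : (n : ℝ) ≤ (c - s) / q₁ := hn ▸ Nat.floor_le (div_nonneg (by linarith) hq₁.le)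
    have hf' : (c - s) / q₁ < n + 1 := hn ▸ Nat.lt_floor_add_one _
    rw [le_div_iff₀ hq₁] at hf
    rw [div_lt_iff₀ hq₁] at hf'
    refine ⟨![s + (n + 1) * q₁, -N * (p₂ + q₂) - (n + 1) * q₂],
      (h.mem_iff _).2 ⟨-N, -N - (n + 1), ?_, ?_⟩, ?_⟩
    · simp [hs]; ring
    · simp; ring
    · simp only [Matrix.cons_val_zero, Matrix.cons_val_one]
      have : 0 < (n + 1) * q₂ := by positivity
      refine ⟨?_, ?_, ?_⟩ <;> linarith
  rcases lt_or_ge s (c + w) with h2 | h2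
  · refine ⟨![s, -N * (p₂ + q₂)], (h.mem_iff _).2 ⟨-N, -N, ?_, ?_⟩, ?_⟩
    · simp [hs]; ring
    · simp; ring
    · simp only [Matrix.cons_val_zero, Matrix.cons_val_one]
      refine ⟨?_, ?_, ?_⟩ <;> linarith
  · obtain ⟨n, hn⟩ : ∃ n : ℕ, n = Nat.floor ((s - (c + w)) / p₁) := ⟨_, rfl⟩
    have hf : (n : ℝ) ≤ (s - (c + w)) / p₁ :=
      hn ▸ Nat.floor_le (div_nonneg (by linarith) hp₁.le)
    have hf' : (s - (c + w)) / p₁ < n + 1 := hn ▸ Nat.lt_floor_add_one _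
    rw [le_div_iff₀ hp₁] at hf
    rw [div_lt_iff₀ hp₁] at hf'
    refine ⟨![s - (n + 1) * p₁, -N * (p₂ + q₂) - (n + 1) * p₂],
      (h.mem_iff _).2 ⟨-N - (n + 1), -N, ?_, ?_⟩, ?_⟩
    · simp [hs]; ring
    · simp; ring
    · simp only [Matrix.cons_val_zero, Matrix.cons_val_one]
      have : 0 < (n + 1) * p₂ := by positivity
      refine ⟨?_, ?_, ?_⟩ <;> linarith

/-- Boxes that are wider than `max p₁ q₁` and higher than `p₂ + q₂` contain lattice points. -/
theorem IsQuadrantBasis.height_le {L : Submodule ℤ (Fin 2 → ℝ)} {p₁ p₂ q₁ q₂ : ℝ}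
    (h : IsQuadrantBasis L p₁ p₂ q₁ q₂) {x y : Fin 2 → ℝ} (hp : p₁ < y 0 - x 0)
    (hq : q₁ < y 0 - x 0) (hd : Disjoint (box x y) (L : Set (Fin 2 → ℝ))) :
    y 1 - x 1 ≤ p₂ + q₂ := by
  by_contra! hlt
  have hδ : 0 < min p₂ q₂ := lt_min h.p₂_pos h.q₂_pos
  -- Climb in the strip of the box from a point below it: each step gains at least `min p₂ q₂`, and
  -- none can jump over a box higher than `p₂ + q₂`. The number `n` bounds the remaining depth below
  -- the box.
  have key : ∀ n : ℕ, ∀ z ∈ L, x 0 < z 0 → z 0 < y 0 → x 1 - n * min p₂ q₂ < z 1 →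
      z 1 < y 1 → False := by
    intro n
    induction n with
    | zero =>
      intro z hz h1 h2 h3 h4
      refine Set.disjoint_left.1 hd ((mem_box_iff _ _ _).2 ⟨⟨h1, h2⟩, ?_, h4⟩) hz
      simpa using h3
    | succ n ih =>
      intro z hz h1 h2 h3 h4
      rcases lt_or_ge (x 1) (z 1) with h5 | h5
      · exact Set.disjoint_left.1 hd ((mem_box_iff _ _ _).2 ⟨⟨h1, h2⟩, h5, h4⟩) hz
      · obtain ⟨z', hz', h6, h7, h8, h9⟩ := h.exists_step hp hq hz h1 (by linarith)
        push_cast at h3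
        exact ih z' hz' h6 (by linarith) (by linarith) (by linarith)
  obtain ⟨z, hz, h1, h2, h3⟩ := h.exists_mem_strip hp hq (x 0) (y 1)
  obtain ⟨n, hn⟩ := exists_nat_gt ((x 1 - z 1) / min p₂ q₂)
  rw [div_lt_iff₀ hδ] at hn
  exact key n z hz h1 (by linarith) (by linarith) h3

theorem mem_latticeOf (A : Matrix (Fin 2) (Fin 2) ℝ) (z : Fin 2 → ℝ) :
    z ∈ latticeOf A ↔
      ∃ a b : ℤ, z 0 = a * A 0 0 + b * A 0 1 ∧ z 1 = a * A 1 0 + b * A 1 1 := by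
  have : Set.range A.col = {A.col 0, A.col 1} := by
    ext v; simp [Fin.exists_fin_two, eq_comm]
  rw [latticeOf, this, Submodule.mem_span_pair]
  refine exists₂_congr fun a b => ?_
  rw [funext_iff, Fin.forall_fin_two]
  simp [Matrix.col, eq_comm]

/- The chain of bases given by the continued fraction expansions -/

/-- A positive two-sided sequence with prescribed ratios of consecutive terms. -/
theorem exists_int_ratio (x : ℤ → ℝ) (hx : ∀ i, 0 < x i) :
    ∃ X : ℤ → ℝ, X 0 = 1 ∧ (∀ i, 0 < X i) ∧ ∀ i, X (i - 1) = X i * x i := by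
  let X : ℤ → ℝ := fun i => match i with
    | Int.ofNat n => ∏ k ∈ Finset.range n, (x (k + 1))⁻¹
    | Int.negSucc n => ∏ k ∈ Finset.range (n + 1), x (-k)
  refine ⟨X, by simp [X], ?_, ?_⟩
  · rintro (n | n)
    · exact Finset.prod_pos fun k _ => inv_pos.2 (hx _)
    · exact Finset.prod_pos fun k _ => hx _
  · rintro (n | n)
    · rcases n with _ | n
      · change ∏ k ∈ Finset.range 1, x (-k) = (∏ k ∈ Finset.range 0, (x (k + 1))⁻¹) * x 0
        simp
      · have h : (Int.ofNat (n + 1) - 1 : ℤ) = Int.ofNat n := by simp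
        rw [h]
        change ∏ k ∈ Finset.range n, (x (k + 1))⁻¹ =
          (∏ k ∈ Finset.range (n + 1), (x (k + 1))⁻¹) * x ((n + 1 : ℕ) : ℤ)
        rw [Finset.prod_range_succ, mul_assoc]
        push_cast
        rw [inv_mul_cancel₀ (hx _).ne', mul_one]
    · have h : (Int.negSucc n - 1 : ℤ) = Int.negSucc (n + 1) := by
        rw [Int.negSucc_eq, Int.negSucc_eq]; push_cast; ring
      rw [h]
      change ∏ k ∈ Finset.range (n + 1 + 1), x (-k) =
        (∏ k ∈ Finset.range (n + 1), x (-k)) * x (Int.negSucc n)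
      rw [Finset.prod_range_succ, Int.negSucc_eq]
      push_cast
      rfl

section Chain

/-- The absolute values `X i`, `Y i` of the coordinates of lattice vectors such that
`((-1) ^ i * X i, Y i)` and `((-1) ^ (i - 1) * X (i - 1), Y (i - 1))` form a basis for every `i`,
where consecutive bases are linked by the partial quotients `a i`. -/
structure IsChain (L : Submodule ℤ (Fin 2 → ℝ)) (a : ℤ → ℕ) (X Y : ℤ → ℝ) : Prop where
  a_pos : ∀ i, 0 < a i
  X_pos : ∀ i, 0 < X i
  Y_pos : ∀ i, 0 < Y i
  X_zero : X 0 = 1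
  X_rec : ∀ i, X (i - 1) = a i * X i + X (i + 1)
  Y_rec : ∀ i, Y (i + 1) = Y (i - 1) + a i * Y i
  mem_iff : ∀ z, z ∈ L ↔ ∃ k l : ℤ, z 0 = k * X 0 - l * X (-1) ∧ z 1 = k * Y 0 + l * Y (-1)

variable {L : Submodule ℤ (Fin 2 → ℝ)} {a : ℤ → ℕ} {X Y : ℤ → ℝ}

/-- Passing from `i` to `i + 1` is a unimodular change of basis that exchanges the two quadrants;
`σ` is the sign `(-1) ^ i`. -/
theorem IsChain.mem_iff_forall (h : IsChain L a X Y) (i : ℤ) :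
    ∃ σ : ℤ, (σ = 1 ∨ σ = -1) ∧ ∀ z, z ∈ L ↔ ∃ k l : ℤ,
      z 0 = σ * (k * X i - l * X (i - 1)) ∧ z 1 = k * Y i + l * Y (i - 1) := by
  induction i using Int.induction_on with
  | zero => exact ⟨1, Or.inl rfl, fun z => by simpa using h.mem_iff z⟩
  | succ i ih =>
    obtain ⟨σ, hσ, ih⟩ := ih
    have hX := h.X_rec i
    have hY := h.Y_rec i
    refine ⟨-σ, by omega, fun z => ?_⟩
    rw [ih z, add_sub_cancel_right]
    constructor
    · rintro ⟨k, l, h0, h1⟩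
      refine ⟨l, k - l * a i, ?_, ?_⟩
      · rw [h0, hX]; push_cast; ring
      · rw [h1, hY]; push_cast; ring
    · rintro ⟨k, l, h0, h1⟩
      refine ⟨l + k * a i, k, ?_, ?_⟩
      · rw [h0, hX]; push_cast; ring
      · rw [h1, hY]; push_cast; ring
  | pred i ih =>
    obtain ⟨σ, hσ, ih⟩ := ih
    have hX := h.X_rec (-i - 1)
    have hY := h.Y_rec (-i - 1)
    rw [sub_add_cancel] at hX hY
    refine ⟨-σ, by omega, fun z => ?_⟩
    rw [ih z]
    constructor
    · rintro ⟨k, l, h0, h1⟩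
      refine ⟨l + k * a (-i - 1), k, ?_, ?_⟩
      · rw [h0, hX]; push_cast; ring
      · rw [h1, hY]; push_cast; ring
    · rintro ⟨k, l, h0, h1⟩
      refine ⟨l, k - l * a (-i - 1), ?_, ?_⟩
      · rw [h0, hX]; push_cast; ring
      · rw [h1, hY]; push_cast; ring

theorem IsChain.X_add_le_sub (h : IsChain L a X Y) {i : ℤ} {j : ℕ} (hj : j < a i) :
    X i + X (i + 1) ≤ X (i - 1) - j * X i := by
  have h1 : (j : ℝ) + 1 ≤ a i := by exact_mod_cast hj
  have := h.X_rec i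
  nlinarith [h.X_pos i]

/-- The intermediate bases. -/
theorem IsChain.isQuadrantBasis (h : IsChain L a X Y) {i : ℤ} {j : ℕ} (hj : j < a i) :
    IsQuadrantBasis L (X i) (Y i) (X (i - 1) - j * X i) (Y (i - 1) + j * Y i) ∨
      IsQuadrantBasis L (X (i - 1) - j * X i) (Y (i - 1) + j * Y i) (X i) (Y i) := by
  have hX := h.X_pos i
  have hY := h.Y_pos i
  have hX' : 0 < X (i - 1) - j * X i := by linarith [h.X_add_le_sub hj, h.X_pos (i + 1)]
  have hY' : 0 < Y (i - 1) + j * Y i := by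
    have := h.Y_pos (i - 1)
    positivity
  obtain ⟨σ, rfl | rfl, hσ⟩ := h.mem_iff_forall i
  · refine Or.inl ⟨hX, hY, hX', hY', fun z => (hσ z).trans ⟨?_, ?_⟩⟩
    · rintro ⟨k, l, h0, h1⟩
      refine ⟨k - l * j, l, ?_, ?_⟩
      · rw [h0]; push_cast; ring
      · rw [h1]; push_cast; ring
    · rintro ⟨k, l, h0, h1⟩
      refine ⟨k + l * j, l, ?_, ?_⟩
      · rw [h0]; push_cast; ring
      · rw [h1]; push_cast; ring
  · refine Or.inr ⟨hX', hY', hX, hY, fun z => (hσ z).trans ⟨?_, ?_⟩⟩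
    · rintro ⟨k, l, h0, h1⟩
      refine ⟨l, k - l * j, ?_, ?_⟩
      · rw [h0]; push_cast; ring
      · rw [h1]; push_cast; ring
    · rintro ⟨l, k, h0, h1⟩
      refine ⟨k + l * j, l, ?_, ?_⟩
      · rw [h0]; push_cast; ring
      · rw [h1]; push_cast; ring

theorem IsChain.X_add_le (h : IsChain L a X Y) (i : ℤ) : X i + X (i + 1) ≤ X (i - 1) := by
  simpa using h.X_add_le_sub (h.a_pos i)

theorem IsChain.X_antitone (h : IsChain L a X Y) : Antitone X := by
  refine antitone_int_of_succ_le fun i => ?_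
  have h1 := h.X_add_le (i + 1)
  rw [add_sub_cancel_right] at h1
  linarith [h.X_pos (i + 1 + 1)]

theorem IsChain.two_mul_X_le (h : IsChain L a X Y) (i : ℤ) : 2 * X (i + 2) ≤ X i := by
  have h1 := h.X_add_le (i + 1)
  have h2 := h.X_antitone (show i + 1 ≤ i + 2 by omega)
  rw [add_sub_cancel_right, show i + 1 + 1 = i + 2 by ring] at h1
  linarith

theorem IsChain.two_pow_mul_X_le (h : IsChain L a X Y) (n : ℕ) (i : ℤ) :
    2 ^ n * X (i + 2 * n) ≤ X i := by
  induction n with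
  | zero => simp
  | succ n ih =>
    have h1 := h.two_mul_X_le (i + 2 * n)
    have h2 : (0 : ℝ) < 2 ^ n := by positivity
    rw [show i + 2 * ((n + 1 : ℕ) : ℤ) = i + 2 * n + 2 by push_cast; ring, pow_succ]
    nlinarith

/-- The sums `X (i - 1) + X i` are the box widths for `j = 0`. They decrease from infinity to zero
because `X` at least halves every two steps; take the last one that is at least `w`. -/
theorem IsChain.exists_index (h : IsChain L a X Y) {w : ℝ} (hw : 0 < w) :
    ∃ i, w ≤ X (i - 1) + X i ∧ X i + X (i + 1) < w := by
  obtain ⟨i, hi, hi'⟩ := Int.exists_greatest_of_bdd (P := fun i => w ≤ X (i - 1) + X i) (by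
      obtain ⟨n, hn⟩ := pow_unbounded_of_one_lt (2 / w) (one_lt_two (α := ℝ))
      refine ⟨2 * n + 1, fun i hi => ?_⟩
      by_contra! hlt
      have h1 := h.two_pow_mul_X_le n 0
      rw [zero_add, h.X_zero] at h1
      have h2 := h.X_antitone (show 2 * (n : ℤ) ≤ i - 1 by omega)
      have h3 := h.X_antitone (show 2 * (n : ℤ) ≤ i by omega)
      rw [div_lt_iff₀ hw] at hn
      have h4 : (0 : ℝ) < 2 ^ n := by positivity
      nlinarith) (by
      obtain ⟨n, hn⟩ := pow_unbounded_of_one_lt w (one_lt_two (α := ℝ))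
      refine ⟨-(2 * n), ?_⟩
      have h1 := h.two_pow_mul_X_le n (-(2 * n))
      rw [neg_add_cancel, h.X_zero] at h1
      linarith [h.X_pos (-(2 * n) - 1)])
  refine ⟨i, hi, ?_⟩
  by_contra! hlt
  have := hi' (i + 1) (by simpa using hlt)
  omega

/-- The larger horizontal extent of a basis is the total width of the next one, so the intervals of
widths fit together. At `j = a i - 1` this extent equals `X i + X (i + 1)`, the width of the first
basis with index `i + 1`. -/
theorem IsChain.exists_basis (h : IsChain L a X Y) {w : ℝ} (hw : 0 < w) :
    ∃ i, ∃ j < a i, X (i - 1) - j * X i < w ∧ w ≤ X (i - 1) - j * X i + X i := by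
  classical
  obtain ⟨i, hi, hi'⟩ := h.exists_index hw
  have hlast : X (i - 1) - (a i - 1 : ℕ) * X i < w := by
    rw [Nat.cast_sub (h.a_pos i), Nat.cast_one, h.X_rec]
    linarith
  have hex : ∃ j : ℕ, X (i - 1) - j * X i < w := ⟨_, hlast⟩
  refine ⟨i, Nat.find hex, ?_, Nat.find_spec hex, ?_⟩
  · have := Nat.find_min' hex hlast
    have := h.a_pos i
    omega
  · rcases Nat.eq_zero_or_pos (Nat.find hex) with h0 | h0
    · rw [h0]; simpa using hi
    · have h1 := Nat.find_min hex (m := Nat.find hex - 1) (Nat.sub_lt h0 one_pos)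
      rw [not_lt, Nat.cast_pred h0] at h1
      linarith

/-- The dispersion is attained by the boxes that belong to the intermediate bases. -/
theorem IsChain.disp_eq (h : IsChain L a X Y) :
    disp L = ⨆ (i : ℤ) (j : ℕ) (_ : j < a i), ENNReal.ofReal
      ((X (i - 1) - j * X i + X i) * (Y (i - 1) + j * Y i + Y i)) := by
  refine le_antisymm (iSup₂_le fun x y => iSup_le fun hd => ?_)
    (iSup₂_le fun i j => iSup_le fun hj => ?_)
  · rw [volume_box]
    rcases le_or_gt (y 0 - x 0) 0 with hw | hw
    · simp [ENNReal.ofReal_of_nonpos hw]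
    obtain ⟨i, j, hj, h1, h2⟩ := h.exists_basis hw
    have h3 := h.X_add_le_sub hj
    have h4 := h.X_pos (i + 1)
    have hY : y 1 - x 1 ≤ Y (i - 1) + j * Y i + Y i := by
      rcases h.isQuadrantBasis hj with hb | hb
      · linarith [hb.height_le (by linarith) h1 hd]
      · linarith [hb.height_le h1 (by linarith) hd]
    refine le_iSup₂_of_le i j (le_iSup_of_le hj ?_)
    rw [← ENNReal.ofReal_mul hw.le]
    have := h.Y_pos i
    have := h.Y_pos (i - 1)
    refine ENNReal.ofReal_le_ofReal ?_
    calc _ ≤ (y 0 - x 0) * (Y (i - 1) + j * Y i + Y i) := by gcongr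
      _ ≤ _ := by gcongr
  · rcases h.isQuadrantBasis hj with hb | hb
    · rw [add_comm (_ - _), add_comm (_ + _) (Y i)]
      exact hb.le_disp
    · exact hb.le_disp

theorem IsChain.det_eq (h : IsChain L a X Y) (i : ℤ) :
    X (i - 1) * Y i + X i * Y (i - 1) = X (-1) * Y 0 + X 0 * Y (-1) := by
  induction i using Int.induction_on with
  | zero => simp
  | succ i ih =>
    have hX := h.X_rec i
    have hY := h.Y_rec i
    rw [← ih, add_sub_cancel_right, hX, hY]
    ring
  | pred i ih =>
    have hX := h.X_rec (-i - 1)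
    have hY := h.Y_rec (-i - 1)
    rw [sub_add_cancel] at hX hY
    rw [← ih, hX, hY]
    ring

end Chain

/-- With the ratios `Δ_i` and `-Δ̃_i`, the box of the basis `(i, j)` has area `X i * Y i * (1 - j +
Δ_i) * (1 + j - Δ̃_i)`. The determinant of every basis is `X i * Y i * (Δ_i - Δ̃_i)` and does not
depend on `i`, so the scale factors cancel. -/
theorem normalizedDisp_eq_seqDisp (L : Submodule ℤ (Fin 2 → ℝ)) (a : ℤ → ℕ)
    (h : HasSequence L a) : normalizedDisp L = seqDisp a := by
  obtain ⟨Δ, Δ', -, -, -, hL, -, ha, rfl, rfl⟩ := h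
  have hx : ∀ i, 0 < genRight a i := fun i => zero_lt_one.trans_le (one_le_genRight a ha i)
  have hy := genLeft_pos a ha
  obtain ⟨X, hX0, hXpos, hX⟩ := exists_int_ratio (genRight a) hx
  obtain ⟨Y, hY0, hYpos, hY⟩ := exists_int_ratio (fun i => -genLeft a i) hy
  have hc : IsChain L a X Y := by
    refine ⟨ha, hXpos, hYpos, hX0, fun i => ?_, fun i => ?_, fun z => ?_⟩
    · have h1 := hX (i + 1)
      rw [add_sub_cancel_right] at h1
      have h2 := hx (i + 1)
      rw [hX i, genRight_eq a ha i, h1]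
      field_simp
    · have h1 := hY (i + 1)
      rw [add_sub_cancel_right] at h1
      have h2 := genLeft_succ a ha i
      have h3 := hy i
      simp only [h2] at h1
      have : (0 : ℝ) < a i + -genLeft a i := by positivity
      rw [hY i, h1]
      field_simp
      ring
    · have h1 := hX 0
      have h2 := hY 0
      simp only [zero_sub, hX0, hY0, one_mul] at h1 h2
      rw [hL, mem_latticeOf, hX0, hY0, h1, h2]
      refine exists₂_congr fun k l => ?_
      simp [sub_eq_add_neg]
  have hdet : ∀ i, X i * Y i * (genRight a i - genLeft a i) = genRight a 0 - genLeft a 0 := by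
    intro i
    have h1 := hc.det_eq i
    have h2 := hc.det_eq 0
    rw [hX i, hY i] at h1
    have h3 := hX 0
    have h4 := hY 0
    rw [zero_sub] at h3 h4
    rw [h3, h4, hX0, hY0] at h1
    linarith
  have hD : ∀ i, 0 < genRight a i - genLeft a i := fun i => by linarith [hx i, hy i]
  have hcov : ZLattice.covolume L = genRight a 0 - genLeft a 0 := by
    have : (!![1, -genRight a 0; 1, -genLeft a 0]).det = genRight a 0 - genLeft a 0 := by
      rw [Matrix.det_fin_two_of]; ring
    rw [hL, covolume_latticeOf _ (by rw [this]; exact (hD 0).ne'), this, abs_of_pos (hD 0)]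
  have hdisp : disp L = ENNReal.ofReal (genRight a 0 - genLeft a 0) * seqDisp a := by
    rw [hc.disp_eq, seqDisp]
    simp only [ENNReal.mul_iSup]
    refine iSup_congr fun i => iSup_congr fun j => iSup_congr fun _ => ?_
    rw [← ENNReal.ofReal_mul (hD 0).le, ← hdet i, hX i, hY i]
    congr 1
    have := (hD i).ne'
    field_simp
    ring
  rw [normalizedDisp, hdisp, hcov, mul_comm, ENNReal.mul_div_cancel_right]
  · simpa using hD 0
  · exact ENNReal.ofReal_ne_top

/- The terms of the dispersion of a sequence -/

/-- The terms of the dispersion are the values `boxArea (1 - j + Δ_i) (1 + j - Δ̃_i)`. -/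
noncomputable def boxArea (A B : ℝ) : ℝ := A * B / (A + B - 2)

theorem boxArea_comm (A B : ℝ) : boxArea A B = boxArea B A := by
  rw [boxArea, boxArea, mul_comm, add_comm A]

/-- For fixed `B` the derivative in `A` has the sign of `B * (B - 2)`. -/
theorem boxArea_mono {A A' B B' : ℝ} (hA : 2 ≤ A) (hB : 2 ≤ B) (hAA : A ≤ A') (hBB : B ≤ B') :
    boxArea A B ≤ boxArea A' B' := by
  have key : ∀ {A A' B : ℝ}, 2 ≤ A → 2 ≤ B → A ≤ A' → boxArea A B ≤ boxArea A' B := by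
    intro A A' B hA hB hAA
    rw [boxArea, boxArea, div_le_div_iff₀ (by linarith) (by linarith)]
    nlinarith [mul_nonneg (mul_nonneg (by linarith : 0 ≤ B) (sub_nonneg.2 hB)) (sub_nonneg.2 hAA)]
  refine (key hA hB hAA).trans ?_
  rw [boxArea_comm, boxArea_comm A']
  exact key hB (by linarith) hBB

/-- Equivalent to `(1 - x) * (1 - y) ≤ 0`. This covers the terms with `j = 0`, where monotonicity
fails because the second argument is below 2. -/
theorem boxArea_le_two {x y : ℝ} (hx : 1 ≤ x) (hy : 0 ≤ y) (hy1 : y ≤ 1) :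
    boxArea (1 + x) (1 + y) ≤ 2 := by
  rw [boxArea, div_le_iff₀ (by linarith)]
  nlinarith

theorem two_le_boxArea {A B : ℝ} (hA : 2 ≤ A) (hB : 2 ≤ B) : 2 ≤ boxArea A B :=
  le_trans (by norm_num [boxArea]) (boxArea_mono le_rfl le_rfl hA hB)

/-- For equal fractional parts `t` the denominator is `m + 2 * t`, and `j` enters only through `(m -
2 * j) ^ 2`; hence the central `j` is optimal. -/
theorem boxArea_eq (m j t : ℝ) (h : m + 2 * t ≠ 0) :
    boxArea (1 + m - j + t) (1 + j + t) =
      (m + 2 * t) / 4 + 1 + (4 - (m - 2 * j) ^ 2) / (4 * (m + 2 * t)) := by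
  obtain ⟨S, hS⟩ : ∃ S, S = m + 2 * t := ⟨_, rfl⟩
  have : 1 + m - j + t + (1 + j + t) - 2 = S := by rw [hS]; ring
  rw [boxArea, this, ← hS]
  rw [← hS] at h
  obtain rfl : m = S - 2 * t := by rw [hS]; ring
  field_simp
  ring

theorem seqDisp_eq (a : ℤ → ℕ) : seqDisp a = ⨆ (i : ℤ) (j : ℕ) (_ : j < a i),
    ENNReal.ofReal (boxArea (1 - j + genRight a i) (1 + j + -genLeft a i)) := by
  refine iSup_congr fun i => iSup_congr fun j => iSup_congr fun _ => ?_
  rw [boxArea]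
  congr 2
  ring

theorem boxArea_le_seqDisp (a : ℤ → ℕ) (ha : ∀ i, 0 < a i) {i : ℤ} {j : ℕ} (hj : j < a i) :
    ENNReal.ofReal (boxArea (1 + a i - j + 1 / genRight a (i + 1)) (1 + j + -genLeft a i)) ≤
      seqDisp a := by
  rw [seqDisp_eq]
  refine le_iSup₂_of_le i j (le_iSup_of_le hj (le_of_eq ?_))
  rw [genRight_eq a ha i]
  congr 2
  ring

theorem seqDisp_le (a : ℤ → ℕ) (ha : ∀ i, 0 < a i) {M : ℝ≥0∞}
    (h : ∀ i, ∀ j < a i, ENNReal.ofReal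
      (boxArea (1 + a i - j + 1 / genRight a (i + 1)) (1 + j + -genLeft a i)) ≤ M) :
    seqDisp a ≤ M := by
  rw [seqDisp_eq]
  refine iSup₂_le fun i j => iSup_le fun hj => le_trans (le_of_eq ?_) (h i j hj)
  rw [genRight_eq a ha i]
  congr 2
  ring

/- Values for the periodic sequences -/

theorem constSeq_pos {m : ℕ} (hm : 1 ≤ m) (i : ℤ) : 0 < constSeq m i := hm

theorem altSeq_pos {m : ℕ} (hm : 1 ≤ m) (i : ℤ) : 0 < altSeq m i := by
  unfold altSeq; split_ifs <;> omega

theorem altSeq_le {m : ℕ} (hm : 1 ≤ m) (i : ℤ) : altSeq m i ≤ m := by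
  unfold altSeq; split_ifs <;> omega

theorem altSeq_one : altSeq 1 = constSeq 1 := by
  funext i; simp [altSeq, constSeq]

theorem genRight_constSeq_sq {m : ℕ} (hm : 1 ≤ m) (i : ℤ) :
    genRight (constSeq m) i ^ 2 = m * genRight (constSeq m) i + 1 := by
  have h := genRight_eq _ (constSeq_pos hm) i
  have h1 := one_le_genRight _ (constSeq_pos hm) i
  have h2 : genRight (constSeq m) (i + 1) = genRight (constSeq m) i := rfl
  rw [h2, show constSeq m i = m from rfl] at h
  generalize genRight (constSeq m) i = x at *
  have hx : 0 < x := by linarith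
  field_simp at h
  linarith

theorem genLeft_constSeq {m : ℕ} (hm : 1 ≤ m) (i : ℤ) :
    -genLeft (constSeq m) i = 1 / genRight (constSeq m) 0 :=
  genLeft_eq _ (constSeq_pos hm) i

theorem genRight_altSeq_zero {m : ℕ} (hm : 1 ≤ m) :
    genRight (altSeq m) 0 = m + 1 / genRight (altSeq m) 1 :=
  genRight_eq _ (altSeq_pos hm) 0

theorem genRight_altSeq_one {m : ℕ} (hm : 1 ≤ m) :
    genRight (altSeq m) 1 = 1 + 1 / genRight (altSeq m) 0 := by
  have h := genRight_eq _ (altSeq_pos hm) 1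
  have h2 : genRight (altSeq m) (1 + 1) = genRight (altSeq m) 0 := by
    unfold genRight altSeq
    congr 1
    funext n
    simp [Int.even_add]
  rw [h2] at h
  simpa [altSeq] using h

theorem genLeft_altSeq_zero {m : ℕ} (hm : 1 ≤ m) :
    -genLeft (altSeq m) 0 = 1 / genRight (altSeq m) 1 := by
  rw [genLeft_eq _ (altSeq_pos hm), sub_zero]
  simp only [altSeq, even_neg]
  rfl

theorem genRight_altSeq_sq {m : ℕ} (hm : 1 ≤ m) :
    genRight (altSeq m) 0 ^ 2 = m * genRight (altSeq m) 0 + m := by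
  have h := genRight_altSeq_zero hm
  rw [genRight_altSeq_one hm] at h
  have h1 := one_le_genRight _ (altSeq_pos hm) 0
  generalize genRight (altSeq m) 0 = x at *
  have hx : 0 < x := by linarith
  field_simp at h
  linarith

/- Extremal continued fractions -/

/-- Two steps of the recursion show that the supremum `S` of all `Δ_i` satisfies `S ≤ m + 1 / (1 + 1
/ S)`, that is `S ^ 2 ≤ m * S + m`. The value for `altSeq` is the positive root of the corresponding
equation. -/
theorem genRight_le {m : ℕ} (hm : 1 ≤ m) (a : ℤ → ℕ) (ha : ∀ i, 0 < a i) (ham : ∀ i, a i ≤ m)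
    (i : ℤ) : genRight a i ≤ genRight (altSeq m) 0 := by
  have ha1 : ∀ i, (1 : ℝ) ≤ a i := fun i => by exact_mod_cast ha i
  have ham' : ∀ i, (a i : ℝ) ≤ m := fun i => by exact_mod_cast ham i
  have h1 := one_le_genRight a ha
  have hbdd : BddAbove (Set.range (genRight a)) := by
    refine ⟨m + 1, ?_⟩
    rintro _ ⟨i, rfl⟩
    rw [genRight_eq a ha]
    have : 1 / genRight a (i + 1) ≤ 1 := (div_le_one (by linarith [h1 (i + 1)])).2 (h1 _)
    linarith [ham' i]
  set S := ⨆ i, genRight a i with hS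
  have hle : ∀ i, genRight a i ≤ S := fun i => le_ciSup hbdd i
  have hS0 : 0 < S := by linarith [hle 0, h1 0]
  have hSle : S ≤ m + S / (S + 1) := by
    refine ciSup_le fun i => ?_
    have h2 : 1 + 1 / S ≤ genRight a (i + 1) := by
      rw [genRight_eq a ha]
      have : 1 / S ≤ 1 / genRight a (i + 1 + 1) :=
        one_div_le_one_div_of_le (by linarith [h1 (i + 1 + 1)]) (hle _)
      linarith [ha1 (i + 1)]
    have h3 : 1 / genRight a (i + 1) ≤ 1 / (1 + 1 / S) :=
      one_div_le_one_div_of_le (by positivity) h2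
    have h4 : 1 / (1 + 1 / S) = S / (S + 1) := by field_simp
    rw [genRight_eq a ha]
    linarith [ham' i]
  refine (hle i).trans ?_
  have hC := genRight_altSeq_sq hm
  have hC1 := one_le_genRight _ (altSeq_pos hm) 0
  have hCm : (m : ℝ) < genRight (altSeq m) 0 := by
    simpa [altSeq] using lt_genRight _ (altSeq_pos hm) 0
  have hSsq : S ^ 2 ≤ m * S + m := by
    have h5 : (S - m) * (S + 1) ≤ S := by
      rw [← le_div_iff₀ (by linarith)]; linarith
    nlinarith
  by_contra! hlt
  nlinarith

theorem le_genRight {m : ℕ} (hm : 1 ≤ m) (a : ℤ → ℕ) (ha : ∀ i, 0 < a i) (ham : ∀ i, a i ≤ m)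
    (i : ℤ) : genRight (altSeq m) 1 ≤ genRight a i := by
  rw [genRight_altSeq_one hm, genRight_eq a ha]
  have h1 := one_le_genRight a ha (i + 1)
  have h2 := one_div_le_one_div_of_le (by linarith) (genRight_le hm a ha ham (i + 1))
  have h3 : (1 : ℝ) ≤ a i := by exact_mod_cast ha i
  linarith

theorem one_div_genRight_le {m : ℕ} (hm : 1 ≤ m) (a : ℤ → ℕ) (ha : ∀ i, 0 < a i)
    (ham : ∀ i, a i ≤ m) (i : ℤ) : 1 / genRight a i ≤ 1 / genRight (altSeq m) 1 :=
  one_div_le_one_div_of_le (by linarith [one_le_genRight _ (altSeq_pos hm) 1])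
    (le_genRight hm a ha ham i)

theorem genLeft_le {m : ℕ} (hm : 1 ≤ m) (a : ℤ → ℕ) (ha : ∀ i, 0 < a i)
    (ham : ∀ i, a i ≤ m) (i : ℤ) : -genLeft a i ≤ 1 / genRight (altSeq m) 1 := by
  rw [genLeft_eq a ha]
  exact one_div_genRight_le hm _ (fun k => ha (-k)) (fun k => ham (-k)) _

/- The upper bound -/

/-- For `j ≥ 1` both arguments are at least 2 and can be increased with `k = j`. For `j = 0` the
term is at most 2, hence at most the term with `k = 1`, which exists because `m ≥ 2`. -/
theorem exists_boxArea_le {m : ℕ} (hm : 2 ≤ m) (a : ℤ → ℕ) (ha : ∀ i, 0 < a i)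
    (ham : ∀ i, a i ≤ m) (i : ℤ) {j : ℕ} (hj : j < a i) :
    ∃ k < m, boxArea (1 + a i - j + 1 / genRight a (i + 1)) (1 + j + -genLeft a i) ≤
      boxArea (1 + m - k + 1 / genRight (altSeq m) 1) (1 + k + 1 / genRight (altSeq m) 1) := by
  have h1 := one_le_genRight a ha (i + 1)
  have hy := genLeft_pos a ha i
  have h2 := one_div_genRight_le (by omega) a ha ham (i + 1)
  have h3 := genLeft_le (by omega) a ha ham i
  have h4 : 0 < 1 / genRight a (i + 1) := by positivity
  have ham' : (a i : ℝ) ≤ m := by exact_mod_cast ham i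
  have hj' : (j : ℝ) + 1 ≤ a i := by exact_mod_cast hj
  have hm' : (2 : ℝ) ≤ m := by exact_mod_cast hm
  rcases Nat.eq_zero_or_pos j with rfl | hj0
  · refine ⟨1, by omega, le_trans ?_ (two_le_boxArea ?_ ?_)⟩
    · have := boxArea_le_two (x := a i + 1 / genRight a (i + 1)) (by push_cast at hj'; linarith)
        hy.le (genLeft_lt_one a ha i).le
      simpa [add_assoc] using this
    · push_cast; linarith
    · push_cast; linarith
  · have hj1 : (1 : ℝ) ≤ j := by exact_mod_cast hj0
    refine ⟨j, lt_of_lt_of_le hj (ham i), boxArea_mono ?_ ?_ ?_ ?_⟩ <;> linarith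

theorem boxArea_le_seqDisp_altSeq {m : ℕ} (hm : 1 ≤ m) {k : ℕ} (hk : k < m) :
    ENNReal.ofReal (boxArea (1 + m - k + 1 / genRight (altSeq m) 1)
      (1 + k + 1 / genRight (altSeq m) 1)) ≤ seqDisp (altSeq m) := by
  have h := boxArea_le_seqDisp (altSeq m) (altSeq_pos hm) (i := 0) (j := k) (by simpa [altSeq])
  rw [genLeft_altSeq_zero hm, zero_add] at h
  simpa [altSeq] using h

theorem eq_constSeq_one (a : ℤ → ℕ) (ha : ∀ i, 0 < a i) (ham : ∀ i, a i ≤ 1) :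
    a = constSeq 1 := by
  funext i
  have := ha i
  have := ham i
  simp only [constSeq]
  omega

theorem seqDisp_le_altSeq {m : ℕ} (hm : 1 ≤ m) (a : ℤ → ℕ) (ha : ∀ i, 0 < a i)
    (ham : ∀ i, a i ≤ m) : seqDisp a ≤ seqDisp (altSeq m) := by
  rcases hm.eq_or_lt with rfl | hm
  · rw [eq_constSeq_one a ha ham, altSeq_one]
  · refine seqDisp_le a ha fun i j hj => ?_
    obtain ⟨k, hk, hle⟩ := exists_boxArea_le hm a ha ham i hj
    exact (ENNReal.ofReal_le_ofReal hle).trans (boxArea_le_seqDisp_altSeq (by omega) hk)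

/- The gap between the bounds -/

theorem boxArea_le_seqDisp_constSeq {m : ℕ} (hm : 1 ≤ m) {k : ℕ} (hk : k < m) :
    ENNReal.ofReal (boxArea (1 + m - k + 1 / genRight (constSeq m) 0)
      (1 + k + 1 / genRight (constSeq m) 0)) ≤ seqDisp (constSeq m) := by
  have h := boxArea_le_seqDisp (constSeq m) (constSeq_pos hm) (i := 0) (j := k) hk
  rw [genLeft_constSeq hm] at h
  exact h

theorem seqDisp_constSeq_one_ne_top : seqDisp (constSeq 1) ≠ ∞ := by
  refine ne_top_of_le_ne_top ENNReal.ofReal_ne_top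
    (b := ENNReal.ofReal (boxArea (1 + (1 : ℕ) - (0 : ℕ) + 1 / genRight (constSeq 1) 0)
      (1 + (0 : ℕ) + 1 / genRight (constSeq 1) 0))) ?_
  refine seqDisp_le _ (constSeq_pos le_rfl) fun i j hj => ?_
  obtain rfl : j = 0 := by simpa [constSeq] using hj
  rw [genLeft_constSeq le_rfl]
  exact le_rfl

theorem seqDisp_altSeq_lt {m : ℕ} (hm : 1 ≤ m) :
    seqDisp (altSeq m) < seqDisp (constSeq m) + 1 / 2 := by
  rcases hm.eq_or_lt with rfl | hm
  · rw [altSeq_one]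
    exact ENNReal.lt_add_right seqDisp_constSeq_one_ne_top (by norm_num)
  have hm1 : 1 ≤ m := by omega
  set γ := 1 / genRight (constSeq m) 0 with hγ
  set β := 1 / genRight (altSeq m) 1 with hβ
  have hγ0 : 0 < γ := by
    have := one_le_genRight _ (constSeq_pos hm1) 0
    positivity
  have hγβ : γ ≤ β := one_div_genRight_le hm1 _ (constSeq_pos hm1) (fun _ => le_rfl) 0
  have hβ0 : 0 < β := hγ0.trans_le hγβ
  have hβ1 : β < 1 := by
    rw [hβ, ← genLeft_altSeq_zero hm1]
    exact genLeft_lt_one _ (altSeq_pos hm1) 0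
  have hm' : (2 : ℝ) ≤ m := by exact_mod_cast hm
  -- `k` is half of `m`, rounded down: the minimiser of `(m - 2 * j) ^ 2`, with minimum 0 or 1.
  obtain ⟨k, hk, hD, hDj⟩ : ∃ k < m, ((m : ℝ) - 2 * k) ^ 2 ≤ 1 ∧
      ∀ j : ℕ, ((m : ℝ) - 2 * k) ^ 2 ≤ ((m : ℝ) - 2 * j) ^ 2 := by
    obtain ⟨k, hk | hk⟩ := Nat.even_or_odd' m
    · refine ⟨k, by omega, ?_, fun j => ?_⟩ <;> rw [hk]
      · norm_num
      · push_cast; rw [sub_self]; simpa using sq_nonneg _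
    · refine ⟨k, by omega, ?_, fun j => ?_⟩ <;> rw [hk]
      · norm_num
      · have hne : (2 * k + 1 - 2 * j : ℤ) ≠ 0 := by omega
        have h : (1 : ℤ) ≤ (2 * k + 1 - 2 * j : ℤ) ^ 2 := Order.one_le_iff_pos.2 (by positivity)
        have h' : (1 : ℝ) ≤ (2 * k + 1 - 2 * j : ℝ) ^ 2 := by exact_mod_cast h
        push_cast
        linarith
  set d := ((m : ℝ) - 2 * k) ^ 2 with hd
  -- In the formula of `boxArea_eq` the increasing part is taken at `β` and the decreasing part at
  -- `γ ≤ β`. So `M` bounds all terms for `β` and exceeds the central term for `γ` by exactly `(β -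
  -- γ) / 2 < 1 / 2`.
  set M := (m + 2 * β) / 4 + 1 + (4 - d) / (4 * (m + 2 * γ)) with hM
  have hlt : M < boxArea (1 + m - k + γ) (1 + k + γ) + 1 / 2 := by
    rw [boxArea_eq _ _ _ (by positivity)]
    linarith
  have hle : ∀ j : ℕ, boxArea (1 + m - j + β) (1 + j + β) ≤ M := by
    intro j
    rw [boxArea_eq _ _ _ (by positivity), hM]
    have h1 : (4 - ((m : ℝ) - 2 * j) ^ 2) / (4 * (m + 2 * β)) ≤ (4 - d) / (4 * (m + 2 * β)) := by
      gcongr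
      exact hDj j
    have h2 : (4 - d) / (4 * (m + 2 * β)) ≤ (4 - d) / (4 * (m + 2 * γ)) := by
      gcongr
      linarith
    linarith
  have hM0 : 0 < M := by
    have : 0 ≤ (4 - d) / (4 * (m + 2 * γ)) := div_nonneg (by linarith) (by positivity)
    positivity
  calc seqDisp (altSeq m) ≤ ENNReal.ofReal M := by
        refine seqDisp_le _ (altSeq_pos hm1) fun i j hj => ENNReal.ofReal_le_ofReal ?_
        obtain ⟨l, -, hl⟩ := exists_boxArea_le hm _ (altSeq_pos hm1) (altSeq_le hm1) i hj
        exact hl.trans (hle l)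
    _ < ENNReal.ofReal (boxArea (1 + m - k + γ) (1 + k + γ) + 1 / 2) :=
        (ENNReal.ofReal_lt_ofReal_iff (hM0.trans hlt)).2 hlt
    _ ≤ ENNReal.ofReal (boxArea (1 + m - k + γ) (1 + k + γ)) + ENNReal.ofReal (1 / 2) :=
        ENNReal.ofReal_add_le
    _ ≤ seqDisp (constSeq m) + 1 / 2 := by
        refine add_le_add (boxArea_le_seqDisp_constSeq hm1 hk) (le_of_eq ?_)
        rw [ENNReal.ofReal_div_of_pos two_pos]
        simp

/- The lower bound -/

/-- Since `m + γ = 1 / γ`, raising the inner fractional part by `t' ≤ t` lowers the first argument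
by at most `γ ^ 2 * t`, whereas the second one gains `t`. As the second argument is the smaller one
at the start and `γ < 1`, the gain prevails. -/
theorem boxArea_le_perturb {m j γ t t' : ℝ} (hj : 1 ≤ j) (hjm : j ≤ m - j) (hγ0 : 0 < γ)
    (hγ : γ * (m + γ) = 1) (ht' : 0 ≤ t') (htt : t' ≤ t) (ht : t ≤ 1 - γ) :
    boxArea (1 + m - j + γ) (1 + j + γ) ≤
      boxArea (1 + m - j + 1 / (m + (γ + t'))) (1 + j + (γ + t)) := by
  have hγ1 : γ < 1 := by nlinarith
  have hu : γ - γ ^ 2 * t ≤ 1 / (m + (γ + t')) := by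
    rw [le_div_iff₀ (by linarith)]
    have h1 : (γ - γ ^ 2 * t) * (m + (γ + t')) = (1 - γ * t) * (1 + γ * t') := by
      linear_combination (1 - γ * t) * hγ
    rw [h1]
    nlinarith [mul_nonneg (mul_nonneg hγ0.le (ht'.trans htt)) (mul_nonneg hγ0.le ht'),
      mul_le_mul_of_nonneg_left htt hγ0.le]
  have hu0 : 0 ≤ γ - γ ^ 2 * t := by
    have : γ * t ≤ 1 := by nlinarith
    nlinarith
  refine le_trans ?_ (boxArea_mono (A := 1 + m - j + (γ - γ ^ 2 * t)) (B := 1 + j + (γ + t))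
    (by linarith) (by linarith) (by linarith) le_rfl)
  rw [boxArea, boxArea, div_le_div_iff₀ (by linarith) (by linarith)]
  obtain ⟨A, hA⟩ : ∃ A, A = 1 + m - j + γ := ⟨_, rfl⟩
  obtain ⟨B, hB⟩ : ∃ B, B = 1 + j + γ := ⟨_, rfl⟩
  rw [show 1 + m - j + (γ - γ ^ 2 * t) = A - γ ^ 2 * t by linarith,
    show 1 + j + (γ + t) = B + t by linarith, ← hA, ← hB]
  have hBA : B ≤ A := by linarith
  have hB2 : 2 + γ ≤ B := by linarith
  have ht0 : 0 ≤ t := ht'.trans htt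
  have k1 : B * (B - 2) ≤ A * (A - 2) := by nlinarith
  have k2 : t * (A + B - 2) ≤ (1 - γ) * (2 * A - 2) := by
    apply mul_le_mul <;> linarith
  have k3 : γ ^ 2 * (2 * A - 2) ≤ A * (A - 2) * (1 + γ) := by
    have h1 : γ * (2 * A - 2) ≤ A * (1 + γ) := by nlinarith
    have h2 : γ * (γ * (2 * A - 2)) ≤ (A - 2) * (A * (1 + γ)) :=
      mul_le_mul (by linarith) h1 (mul_nonneg hγ0.le (by linarith)) (by linarith)
    linarith
  -- After clearing denominators and cancelling the common terms, the claim is `t` times this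
  -- inequality.
  have k4 : γ ^ 2 * (B * (B - 2)) + γ ^ 2 * (t * (A + B - 2)) ≤ A * (A - 2) := by
    have h1 := mul_le_mul_of_nonneg_left k1 (sq_nonneg γ)
    have h2 := mul_le_mul_of_nonneg_left k2 (sq_nonneg γ)
    have h3 := mul_le_mul_of_nonneg_left k3 (sub_nonneg.2 hγ1.le)
    linarith
  linarith [mul_le_mul_of_nonneg_left k4 ht0]

/-- Below, `ε i` and `y i` are the fractional parts to the right and to the left of position `i`. If
both are at least `γ` at an entry `m`, monotonicity suffices; otherwise one moves to a neighbour. -/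
theorem exists_le_boxArea {m : ℕ} (hm : 1 ≤ m) (a : ℤ → ℕ) (ha : ∀ i, 0 < a i)
    (ham : ∀ i, a i ≤ m) {i₀ : ℤ} (hi₀ : a i₀ = m) {j : ℕ} (hj : 1 ≤ j) (hjm : 2 * j ≤ m) :
    ∃ i, a i = m ∧ ∃ k < m,
      boxArea (1 + m - j + 1 / genRight (constSeq m) 0) (1 + j + 1 / genRight (constSeq m) 0) ≤
      boxArea (1 + m - k + 1 / genRight a (i + 1)) (1 + k + -genLeft a i) := by
  have hX1 := one_le_genRight _ (constSeq_pos hm) 0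
  have hXm : (m : ℝ) < genRight (constSeq m) 0 := lt_genRight _ (constSeq_pos hm) 0
  have hXsq := genRight_constSeq_sq hm 0
  set γ := 1 / genRight (constSeq m) 0 with hγdef
  have hγ0 : 0 < γ := by positivity
  have hγm : γ < 1 / m := one_div_lt_one_div_of_lt (by exact_mod_cast hm) hXm
  have hγ : γ * (m + γ) = 1 := by
    have hne : genRight (constSeq m) 0 ≠ 0 := by positivity
    rw [hγdef]
    field_simp
    linarith
  have hγ' : γ = 1 / (m + γ) := by
    rw [eq_div_iff (by positivity)]; exact hγ
  set ε : ℤ → ℝ := fun i => 1 / genRight a (i + 1) with hεdef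
  set y : ℤ → ℝ := fun i => -genLeft a i with hydef
  have hε0 : ∀ i, 0 < ε i := fun i => by
    have := one_le_genRight a ha (i + 1)
    positivity
  have hy0 : ∀ i, 0 < y i := genLeft_pos a ha
  have hε1 : ∀ i, ε i < 1 := fun i => by
    have := one_lt_genRight a ha (i + 1)
    exact (div_lt_one (by linarith)).2 this
  have hy1 : ∀ i, y i < 1 := genLeft_lt_one a ha
  have hεs : ∀ i, ε i = 1 / (a (i + 1) + ε (i + 1)) := fun i => by
    rw [hεdef]; simp only; rw [genRight_eq a ha (i + 1)]
  have hys : ∀ i, y (i + 1) = 1 / (a i + y i) := genLeft_succ a ha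
  have hj' : (1 : ℝ) ≤ j := by exact_mod_cast hj
  have hjm' : (2 : ℝ) * j ≤ m := by exact_mod_cast hjm
  have hm0 : (0 : ℝ) < m := by linarith
  -- A quotient of at most `m - 1` would give a fractional part above `1 / m`, which exceeds `γ`.
  have eq_m : ∀ i t, 0 < t → t < 1 → 1 / (a i + t) < γ → a i = m := by
    intro i t ht ht1 h
    by_contra hne
    have h1 : (a i : ℝ) + 1 ≤ m := by exact_mod_cast lt_of_le_of_ne (ham i) hne
    have h2 : 1 / (m : ℝ) ≤ 1 / (a i + t) :=
      one_div_le_one_div_of_le (by positivity) (by linarith)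
    linarith
  have gt_γ : ∀ t, 0 < t → 1 / (m + t) < γ → γ < t := by
    intro t ht h
    by_contra! hle
    have := one_div_le_one_div_of_le (by positivity) (add_le_add_right hle (m : ℝ))
    linarith
  have large : ∀ i, a i = m → γ ≤ ε i → γ ≤ y i → ∃ i, a i = m ∧ ∃ k < m,
      boxArea (1 + m - j + γ) (1 + j + γ) ≤ boxArea (1 + m - k + ε i) (1 + k + y i) := by
    intro i hi h1 h2
    refine ⟨i, hi, j, by omega, boxArea_mono ?_ ?_ ?_ ?_⟩ <;> linarith
  have small : ∀ i, a i = m → ε i < γ → ∃ i, a i = m ∧ ∃ k < m,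
      boxArea (1 + m - j + γ) (1 + j + γ) ≤ boxArea (1 + m - k + ε i) (1 + k + y i) := by
    intro i hi h1
    have h2 := h1
    rw [hεs] at h2
    have hi' := eq_m _ _ (hε0 _) (hε1 _) h2
    rw [hi'] at h2
    have h3 := gt_γ _ (hε0 _) h2
    rcases le_or_gt γ (y (i + 1)) with h4 | h4
    · exact large _ hi' h3.le h4
    rw [hys, hi] at h4
    have h5 := gt_γ _ (hy0 _) h4
    -- Now positions `i` and `i + 1` both carry `m`, with outer fractional parts `γ + t` on the left
    -- and `γ + t'` on the right. The position next to the larger excess is used; at `i + 1` the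
    -- picture is mirrored, so `j` becomes `m - j`.
    obtain ⟨t, ht⟩ : ∃ t, t = y i - γ := ⟨_, rfl⟩
    obtain ⟨t', ht'⟩ : ∃ t, t = ε (i + 1) - γ := ⟨_, rfl⟩
    have ey : y i = γ + t := by rw [ht]; ring
    have eε : ε (i + 1) = γ + t' := by rw [ht']; ring
    have hyi := hy1 i
    have hεi := hε1 (i + 1)
    rcases le_total t' t with h6 | h6
    · refine ⟨i, hi, j, by omega, ?_⟩
      rw [hεs, hi', eε, ey]
      exact boxArea_le_perturb hj' (by linarith) hγ0 hγ (by linarith) h6 (by linarith)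
    · refine ⟨i + 1, hi', m - j, by omega, ?_⟩
      rw [hys, hi, eε, ey, boxArea_comm (1 + m - (m - j : ℕ) + _)]
      have h7 := boxArea_le_perturb hj' (by linarith) hγ0 hγ (by linarith) h6 (by linarith)
      rw [Nat.cast_sub (by omega)]
      convert h7 using 2 <;> ring
  rcases le_or_gt γ (ε i₀) with h1 | h1
  · rcases le_or_gt γ (y i₀) with h2 | h2
    · exact large i₀ hi₀ h1 h2
    · have h3 := hys (i₀ - 1)
      rw [sub_add_cancel] at h3
      rw [h3] at h2
      have hi := eq_m _ _ (hy0 _) (hy1 _) h2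
      rw [hi] at h2
      rcases le_or_gt γ (ε (i₀ - 1)) with h4 | h4
      · exact large _ hi h4 (gt_γ _ (hy0 _) h2).le
      · exact small _ hi h4
  · exact small i₀ hi₀ h1

theorem seqDisp_constSeq_le {m : ℕ} (hm : 1 ≤ m) (a : ℤ → ℕ) (ha : ∀ i, 0 < a i)
    (ham : ∀ i, a i ≤ m) {i₀ : ℤ} (hi₀ : a i₀ = m) : seqDisp (constSeq m) ≤ seqDisp a := by
  rcases hm.eq_or_lt with rfl | hm2
  · rw [eq_constSeq_one a ha ham]
  set γ := 1 / genRight (constSeq m) 0 with hγ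
  have hγ0 : 0 < γ := by
    have := one_le_genRight _ (constSeq_pos hm) 0
    positivity
  have hγ1 : γ < 1 := by
    rw [hγ, ← genLeft_constSeq hm 0]
    exact genLeft_lt_one _ (constSeq_pos hm) 0
  have hm2' : (2 : ℝ) ≤ m := by exact_mod_cast hm2
  have key : ∀ j : ℕ, 1 ≤ j → 2 * j ≤ m →
      ENNReal.ofReal (boxArea (1 + m - j + γ) (1 + j + γ)) ≤ seqDisp a := by
    intro j hj hjm
    obtain ⟨i, hi, k, hk, hle⟩ := exists_le_boxArea hm a ha ham hi₀ hj hjm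
    refine (ENNReal.ofReal_le_ofReal hle).trans ?_
    have := boxArea_le_seqDisp a ha (i := i) (j := k) (by omega)
    rwa [hi] at this
  refine seqDisp_le _ (constSeq_pos hm) fun i j hj => ?_
  have hj : j < m := hj
  rw [genLeft_constSeq hm]
  change ENNReal.ofReal (boxArea (1 + m - j + γ) (1 + j + γ)) ≤ _
  -- The term `j = 0` is dominated by `j = 1`, and `j` can be replaced by `m - j` because the
  -- constant sequence has equal fractional parts on both sides.
  rcases Nat.eq_zero_or_pos j with rfl | hj0
  · refine le_trans (ENNReal.ofReal_le_ofReal ?_) (key 1 le_rfl (by omega))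
    refine le_trans ?_ (two_le_boxArea (by push_cast; linarith) (by push_cast; linarith))
    have := boxArea_le_two (x := m + γ) (y := γ) (by linarith) hγ0.le hγ1.le
    simpa [add_assoc] using this
  rcases le_or_gt (2 * j) m with h | h
  · exact key j hj0 h
  · have h1 := key (m - j) (by omega) (by omega)
    rw [boxArea_comm, Nat.cast_sub hj.le] at h1
    convert h1 using 3 <;> ring

/- Quadratic lattices -/

theorem eq_and_eq_of_irrational {x : ℝ} (hx : Irrational x) {r s r' s' : ℚ}
    (h : (r : ℝ) + s * x = r' + s' * x) : r = r' ∧ s = s' := by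
  have hs : s = s' := by
    by_contra hne
    have hne' : ((s : ℝ) - s') ≠ 0 := sub_ne_zero.2 (by exact_mod_cast hne)
    refine hx ⟨(r' - r) / (s - s'), ?_⟩
    push_cast
    rw [div_eq_iff hne']
    linarith
  subst hs
  exact ⟨by exact_mod_cast add_right_cancel h, rfl⟩

theorem mem_adjoin_iff_of_sq {δ : ℝ} {m n : ℕ} (hδ : δ ^ 2 = m * δ + n) (x : ℝ) :
    x ∈ Algebra.adjoin ℤ ({δ} : Set ℝ) ↔ ∃ k l : ℤ, x = k + l * δ := by
  constructor
  · intro hx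
    induction hx using Algebra.adjoin_induction with
    | mem x hx => exact ⟨0, 1, by simpa using hx⟩
    | algebraMap r => exact ⟨r, 0, by simp⟩
    | add x y _ _ hx hy =>
      obtain ⟨k, l, rfl⟩ := hx
      obtain ⟨k', l', rfl⟩ := hy
      exact ⟨k + k', l + l', by push_cast; ring⟩
    | mul x y _ _ hx hy =>
      obtain ⟨k, l, rfl⟩ := hx
      obtain ⟨k', l', rfl⟩ := hy
      refine ⟨k * k' + n * l * l', k * l' + k' * l + m * l * l', ?_⟩
      push_cast
      linear_combination (l * l' : ℝ) * hδ
  · rintro ⟨k, l, rfl⟩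
    have hδ' := Algebra.subset_adjoin (R := ℤ) (Set.mem_singleton δ)
    refine add_mem (intCast_mem _ k) (mul_mem (intCast_mem _ l) hδ')

/-- A parity argument modulo 4: `d` is not divisible by 4. If `d % 4 = 1`, then `m` and `f` have
equal parity; otherwise both are even. -/
theorem mem_adjoin_intGen {d f m : ℕ} (hd : Squarefree d) {q : ℕ} (h : m ^ 2 + 4 * q = f ^ 2 * d) :
    (m + f * √(d : ℝ)) / 2 ∈ Algebra.adjoin ℤ ({intGen d} : Set ℝ) := by
  have hg := Algebra.subset_adjoin (R := ℤ) (Set.mem_singleton (intGen d))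
  have hcomb : ∀ k l : ℤ, (k + l * intGen d : ℝ) ∈ Algebra.adjoin ℤ ({intGen d} : Set ℝ) :=
    fun k l => add_mem (intCast_mem _ k) (mul_mem (intCast_mem _ l) hg)
  have hmod : (m % 4) ^ 2 % 4 = (f % 4) ^ 2 * (d % 4) % 4 := by
    have : m ^ 2 % 4 = f ^ 2 * d % 4 := by omega
    simpa [Nat.pow_mod, Nat.mul_mod] using this
  have hd4 : d % 4 ≠ 0 := fun h0 => by
    have := Nat.isUnit_iff.1 (hd 2 (by omega))
    omega
  have hm4 : m % 4 < 4 := Nat.mod_lt _ (by norm_num)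
  have hf4 : f % 4 < 4 := Nat.mod_lt _ (by norm_num)
  have hd4' : d % 4 < 4 := Nat.mod_lt _ (by norm_num)
  by_cases h1 : d % 4 = 1
  · have hpar : m % 2 = f % 2 := by
      rw [h1] at hmod
      rw [← Nat.mod_mod_of_dvd m (by norm_num : 2 ∣ 4), ← Nat.mod_mod_of_dvd f (by norm_num : 2 ∣ 4)]
      generalize m % 4 = u at *
      generalize f % 4 = v at *
      interval_cases u <;> interval_cases v <;> simp_all
    obtain ⟨k, hk⟩ : ∃ k : ℤ, (m : ℤ) - f = 2 * k := ⟨(m - f) / 2, by omega⟩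
    have hk' : (m : ℝ) - f = 2 * k := by exact_mod_cast hk
    convert hcomb k f using 1
    rw [intGen, if_pos h1]
    push_cast
    linarith
  · have hpar : m % 2 = 0 ∧ f % 2 = 0 := by
      rw [← Nat.mod_mod_of_dvd m (by norm_num : 2 ∣ 4), ← Nat.mod_mod_of_dvd f (by norm_num : 2 ∣ 4)]
      generalize m % 4 = u at *
      generalize f % 4 = v at *
      generalize d % 4 = w at *
      interval_cases w <;> interval_cases u <;> interval_cases v <;> simp_all
    obtain ⟨k, hk⟩ : ∃ k, m = 2 * k := ⟨m / 2, by omega⟩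
    obtain ⟨l, hl⟩ : ∃ l, f = 2 * l := ⟨f / 2, by omega⟩
    convert hcomb k l using 1
    rw [intGen, if_neg h1, hk, hl]
    push_cast
    ring

/-- Here `δ` and `δ'` are the two roots of `x ^ 2 = m * x + n`, hence conjugate. As `ℤ[δ]` consists
of the `k + l * δ`, the lattice is its image under the two embeddings. Writing the discriminant as
`f ^ 2 * d` with `d` squarefree identifies the field. -/
theorem isQuadraticLattice_of_root {m n : ℕ} (hns : ¬ IsSquare (m ^ 2 + 4 * n)) {δ δ' : ℝ}
    (hδ : δ ^ 2 = m * δ + n) (hsum : δ + δ' = m) (hlt : δ' < δ) :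
    IsQuadraticLattice (latticeOf !![1, -δ; 1, -δ']) ∧
      IsIrrationalLattice (latticeOf !![1, -δ; 1, -δ']) := by
  obtain ⟨d, f, hdf, hd⟩ := Nat.sq_mul_squarefree (m ^ 2 + 4 * n)
  have hdns : ¬ IsSquare d := by
    rintro ⟨e, rfl⟩
    exact hns ⟨f * e, by rw [← hdf]; ring⟩
  have hd1 : 1 < d := by
    rcases d with _ | _ | d
    · exact absurd ⟨0, rfl⟩ hdns
    · exact absurd ⟨1, rfl⟩ hdns
    · omega
  have hf : f ≠ 0 := by
    rintro rfl
    exact hns ⟨0, by rw [← hdf]; simp⟩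
  have hirr : Irrational √(d : ℝ) := irrational_sqrt_natCast_iff.2 hdns
  have hdiff : δ - δ' = f * √(d : ℝ) := by
    have h1 : (δ - δ') ^ 2 = (f * √(d : ℝ)) ^ 2 := by
      rw [mul_pow, Real.sq_sqrt (by positivity)]
      have : (f : ℝ) ^ 2 * d = m ^ 2 + 4 * n := by exact_mod_cast hdf
      rw [this, ← hsum]
      linear_combination 4 * hδ - 4 * δ * hsum
    exact (pow_left_inj₀ (by linarith) (by positivity) two_ne_zero).1 h1
  have eδ : δ = (m + f * √(d : ℝ)) / 2 := by linarith
  have eδ' : δ' = (m - f * √(d : ℝ)) / 2 := by linarith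
  have hδirr : Irrational δ := by
    rintro ⟨q, hq⟩
    have h1 : ((q : ℚ) : ℝ) + (0 : ℚ) * √(d : ℝ) = (m / 2 : ℚ) + (f / 2 : ℚ) * √(d : ℝ) := by
      rw [hq, eδ]; push_cast; ring
    have h2 := (eq_and_eq_of_irrational hirr h1).2
    have : (f : ℚ) ≠ 0 := by exact_mod_cast hf
    apply this
    linarith
  have hδ'irr : Irrational δ' := by
    have : δ' = m - δ := by linarith
    rw [this]
    exact hδirr.natCast_sub m
  refine ⟨⟨d, δ, hd1, hd, hδirr, ?_, fun p => ?_⟩, ?_⟩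
  · rw [eδ]
    exact mem_adjoin_intGen hd hdf.symm
  · rw [mem_latticeOf]
    constructor
    · rintro ⟨k, l, h0, h1⟩
      simp only [Matrix.of_apply, Matrix.cons_val_zero, Matrix.cons_val_one] at h0 h1
      have e0 : ((k - l * m / 2 : ℚ) : ℝ) + (-l * f / 2 : ℚ) * √(d : ℝ) = p 0 := by
        rw [h0, eδ]; push_cast; ring
      have e1 : ((k - l * m / 2 : ℚ) : ℝ) - (-l * f / 2 : ℚ) * √(d : ℝ) = p 1 := by
        rw [h1, eδ']; push_cast; ring
      refine ⟨k - l * m / 2, -l * f / 2, ?_, ?_⟩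
      · rw [e0, mem_adjoin_iff_of_sq hδ]
        exact ⟨k, -l, by rw [h0]; push_cast; ring⟩
      · rw [e0, e1]
        ext i
        fin_cases i <;> rfl
    · rintro ⟨r, s, hrs, rfl⟩
      obtain ⟨k, l, hkl⟩ := (mem_adjoin_iff_of_sq hδ _).1 hrs
      have h1 : (r : ℝ) + s * √(d : ℝ) = (k + l * m / 2 : ℚ) + (l * f / 2 : ℚ) * √(d : ℝ) := by
        rw [hkl, eδ]; push_cast; ring
      obtain ⟨rfl, rfl⟩ := eq_and_eq_of_irrational hirr h1
      refine ⟨k, -l, ?_, ?_⟩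
      · simp [eδ]; ring
      · simp [eδ']; ring
  · have key : ∀ x : ℝ, Irrational x → ∀ k l k' l' : ℤ,
        (k : ℝ) * 1 + l * -x = k' * 1 + l' * -x → k = k' ∧ l = l' := by
      intro x hx k l k' l' h
      have h1 : ((k : ℚ) : ℝ) + (l : ℚ) * -x = (k' : ℚ) + (l' : ℚ) * -x := by
        push_cast; linarith
      have h2 := eq_and_eq_of_irrational hx.neg h1
      exact ⟨by exact_mod_cast h2.1, by exact_mod_cast h2.2⟩
    intro p hp q hq i hpq
    obtain ⟨k, l, h0, h1⟩ := (mem_latticeOf _ _).1 hp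
    obtain ⟨k', l', h0', h1'⟩ := (mem_latticeOf _ _).1 hq
    have hkl : k = k' ∧ l = l' := by
      fin_cases i
      · refine key δ hδirr _ _ _ _ ?_
        simpa [h0, h0'] using hpq
      · refine key δ' hδ'irr _ _ _ _ ?_
        simpa [h1, h1'] using hpq
    obtain ⟨rfl, rfl⟩ := hkl
    ext i
    fin_cases i
    · exact h0.trans h0'.symm
    · exact h1.trans h1'.symm

theorem exists_quadratic_of_root {a : ℤ → ℕ} (ha : ∀ i, 0 < a i) {m n : ℕ}
    (hns : ¬ IsSquare (m ^ 2 + 4 * n)) (hδ : genRight a 0 ^ 2 = m * genRight a 0 + n)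
    (hsum : genRight a 0 + genLeft a 0 = m) :
    ∃ L : Submodule ℤ (Fin 2 → ℝ), IsQuadraticLattice L ∧ HasSequence L a ∧
      normalizedDisp L = seqDisp a := by
  have h1 := genLeft_pos a ha 0
  have h2 := genLeft_lt_one a ha 0
  have h3 := one_lt_genRight a ha 0
  obtain ⟨hq, hirr⟩ := isQuadraticLattice_of_root hns hδ hsum (by linarith)
  have hseq : HasSequence (latticeOf !![1, -genRight a 0; 1, -genLeft a 0]) a :=
    ⟨_, _, h3, by linarith, by linarith, rfl, hirr, ha, rfl, rfl⟩
  exact ⟨_, hq, hseq, normalizedDisp_eq_seqDisp _ _ hseq⟩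

/-- The number lies strictly between `m ^ 2` and `(m + 2) ^ 2` and differs from `(m + 1) ^ 2` by
parity. -/
theorem not_isSquare_sq_add_four {m : ℕ} (hm : 1 ≤ m) : ¬ IsSquare (m ^ 2 + 4 * 1) := by
  rintro ⟨e, he⟩
  have h1 : m < e := by nlinarith
  rcases Nat.lt_or_ge e (m + 2) with h2 | h2
  · obtain rfl : e = m + 1 := by omega
    have : 2 * m = 3 := by linarith
    omega
  · nlinarith

theorem not_isSquare_sq_add_four_mul {m : ℕ} (hm : 1 ≤ m) : ¬ IsSquare (m ^ 2 + 4 * m) := by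
  rintro ⟨e, he⟩
  have h1 : m < e := by nlinarith
  rcases Nat.lt_or_ge e (m + 2) with h2 | h2
  · obtain rfl : e = m + 1 := by omega
    have : 2 * m = 1 := by linarith
    omega
  · nlinarith

end LatticeDispersion

theorem mainTheorem3 (m : ℕ) (hm : 1 ≤ m) :
    (∀ (L : Submodule ℤ (Fin 2 → ℝ)) (a : ℤ → ℕ), HasSequence L a →
      IsGreatest (Set.range a) m →
        seqDisp (constSeq m) ≤ normalizedDisp L ∧ normalizedDisp L ≤ seqDisp (altSeq m)) ∧
    (∃ L : Submodule ℤ (Fin 2 → ℝ), IsQuadraticLattice L ∧ HasSequence L (constSeq m) ∧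
      normalizedDisp L = seqDisp (constSeq m)) ∧
    (∃ L : Submodule ℤ (Fin 2 → ℝ), IsQuadraticLattice L ∧ HasSequence L (altSeq m) ∧
      normalizedDisp L = seqDisp (altSeq m)) ∧
    seqDisp (altSeq m) < seqDisp (constSeq m) + 1 / 2 := by
  refine ⟨fun L a hL hmax => ?_, ?_, ?_, seqDisp_altSeq_lt hm⟩
  · obtain ⟨⟨i₀, hi₀⟩, hmax⟩ := hmax
    have ham : ∀ i, a i ≤ m := fun i => hmax ⟨i, rfl⟩
    have ha : ∀ i, 0 < a i := by
      obtain ⟨_, _, -, -, -, -, -, ha, -⟩ := hL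
      exact ha
    rw [normalizedDisp_eq_seqDisp L a hL]
    exact ⟨seqDisp_constSeq_le hm a ha ham hi₀, seqDisp_le_altSeq hm a ha ham⟩
  · have hsq := genRight_constSeq_sq hm 0
    have hleft := genLeft_constSeq hm 0
    have h1 := one_le_genRight _ (constSeq_pos hm) 0
    refine exists_quadratic_of_root (constSeq_pos hm) (not_isSquare_sq_add_four hm)
      (by simpa using hsq) ?_
    rw [← neg_neg (genLeft _ _), hleft]
    have hne : genRight (constSeq m) 0 ≠ 0 := by positivity
    field_simp
    linarith
  · refine exists_quadratic_of_root (altSeq_pos hm) (not_isSquare_sq_add_four_mul hm)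
      (genRight_altSeq_sq hm) ?_
    rw [← neg_neg (genLeft _ _), genLeft_altSeq_zero hm, genRight_altSeq_zero hm]
    ring
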